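/- Let $\Omega\subset\mathbb R^n$ be a nonempty open connected set with $C^1$ boundary $\Gamma=\partial\Omega$. Let $H:\overline\Omega\times\mathbb R^n\to\mathbb R$ be continuous with $H(x,\cdot)$ convex for each $x\in\overline\Omega$ (no coercivity is assumed), let $g:\Gamma\to\mathbb R$ be continuous, and let $\gamma:\Gamma\to\mathbb R^n$ be continuous and oblique, i.e. $\nu(x)\cdot\gamma(x)>0$ for $x\in\Gamma$, where $\nu(x)$ is the outer unit normal at $x$. Let $U\subset\mathbb R^n$ be open and set $\Sigma=U\cap\overline\Omega$. For $f\in C(\Sigma)$ consider the problem $$H(x,Du)=f(x)\ \text{ in } U\cap\Omega,\qquad D_\gamma u(x):=\gamma(x)\cdot Du(x)=g(x)\ \text{ on } U\cap\Gamma. \tag{P$_f$}$$ A function $u:\Sigma\to\mathbb R$ is a (viscosity) subsolution of (P$_f$) if it is locally bounded above on $\Sigma$ and, whenever $\phi\in C^1(\Sigma)$ (the restriction to $\Sigma$ of a $C^1$ function on $U$) and $u^*-\phi$ attains its maximum over $\Sigma$ at $x\in\Sigma$, where $u^*$ is the upper semicontinuous envelope of $u$ on $\Sigma$, one has $H(x,D\phi(x))\le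 f(x)$ if $x\in\Omega$, and $H(x,D\phi(x))\le f(x)$ or $\gamma(x)\cdot D\phi(x)\le g(x)$ if $x\in\Gamma$. **Theorem 2.2.** For $k\in\mathbb N$ let $f_k\in C(\Sigma)$ and let $u_k:\Sigma\to\mathbb R$ be a locally Lipschitz subsolution of (P$_{f_k}$). Let $\lambda_k\ge 0$ with $\sum_{k\in\mathbb N}\lambda_k=1$, and assume that the sequences $\{u_k\}$ and $\{f_k\}$ are uniformly bounded on each compact subset of $\Sigma$. Then for every $x\in\Sigma$ the series $$u(x)=\sum_{k\in\mathbb N}\lambda_ku_k(x),\qquad f(x)=\sum_{k\in\mathbb N}\lambda_kf_k(x)$$ converge, $f\in C(\Sigma)$, and $u$ is a subsolution of (P$_f$). -/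

import Mathlib

open Set Filter Topology

noncomputable section

namespace ObliqueHJ

/-- The Euclidean space of dimension `n`. -/
abbrev E (n : ℕ) : Type := EuclideanSpace ℝ (Fin n)

/-- In the open set `W`, the set `Ω` is the sublevel set `{ρ < 0}` of a `C¹` function `ρ`
without critical points. -/
structure IsLocalDefiningFunction {n : ℕ} (Ω W : Set (E n)) (ρ : E n → ℝ) : Prop where
  isOpen : IsOpen W
  contDiffOn : ContDiffOn ℝ 1 ρ W
  gradient_ne_zero : ∀ y ∈ W, gradient ρ y ≠ 0
  inter_eq : Ω ∩ W = {y ∈ W | ρ y < 0}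

/-- `Ω` has a `C¹` boundary (and lies locally on one side of it). -/
def HasC1Boundary {n : ℕ} (Ω : Set (E n)) : Prop :=
  ∀ x ∈ frontier Ω, ∃ (W : Set (E n)) (ρ : E n → ℝ), x ∈ W ∧ IsLocalDefiningFunction Ω W ρ

/-- `ν` is the outer unit normal vector to `Ω` at the boundary point `x`: the normalized gradient
at `x` of a local defining function. It does not depend on the choice of that function, and
it exists at every boundary point of a set with `C¹` boundary. -/
def IsOuterUnitNormal {n : ℕ} (Ω : Set (E n)) (x ν : E n) : Prop :=
  ∃ (W : Set (E n)) (ρ : E n → ℝ), x ∈ W ∧ IsLocalDefiningFunction Ω W ρ ∧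
    ν = ‖gradient ρ x‖⁻¹ • gradient ρ x

/-- The vector field `γ` is oblique to the boundary of `Ω`: `ν(x) · γ(x) > 0`, where `ν(x)` is the
outer unit normal. -/
def IsOblique {n : ℕ} (Ω : Set (E n)) (γ : E n → E n) : Prop :=
  ∀ x ∈ frontier Ω, ∀ ν : E n, IsOuterUnitNormal Ω x ν → 0 < inner ℝ ν (γ x)

/-- The upper semicontinuous envelope `w^*` of a function on `S`, at points of `S`
(for `w` locally bounded above on `S`). -/
def uscEnvelope {n : ℕ} (S : Set (E n)) (w : E n → ℝ) (x : E n) : ℝ :=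
  limsup w (𝓝[S] x)

/-- `w` is locally bounded above on `S`. -/
def LocallyBoundedAboveOn {n : ℕ} (S : Set (E n)) (w : E n → ℝ) : Prop :=
  ∀ x ∈ S, ∃ M : ℝ, ∀ᶠ y in 𝓝[S] x, w y ≤ M

/-- `u` is a viscosity subsolution of `H(x, Du) = f` in `U ∩ Ω`, `D_γ u = g` on `U ∩ ∂Ω`.
The function `u` lives on `Σ = U ∩ closure Ω`. The test functions are the `C¹` functions on `Σ`,
taken as restrictions to the relatively closed subset `Σ` of `U` of `C¹` functions on `U`;
the maximum is over `Σ`. -/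
structure IsSubsolution {n : ℕ} (Ω U : Set (E n)) (H : E n → E n → ℝ) (γ : E n → E n)
    (g f u : E n → ℝ) : Prop where
  locallyBoundedAbove : LocallyBoundedAboveOn (U ∩ closure Ω) u
  interior_ineq : ∀ φ : E n → ℝ, ContDiffOn ℝ 1 φ U → ∀ x ∈ U ∩ Ω,
    IsMaxOn (fun y => uscEnvelope (U ∩ closure Ω) u y - φ y) (U ∩ closure Ω) x →
      H x (gradient φ x) ≤ f x
  boundary_ineq : ∀ φ : E n → ℝ, ContDiffOn ℝ 1 φ U → ∀ x ∈ U ∩ frontier Ω,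
    IsMaxOn (fun y => uscEnvelope (U ∩ closure Ω) u y - φ y) (U ∩ closure Ω) x →
      H x (gradient φ x) ≤ f x ∨ inner ℝ (γ x) (gradient φ x) ≤ g x

/-- The sequence `w` is uniformly bounded on each compact subset of `S`. -/
def UniformlyBoundedOnCompacts {n : ℕ} (S : Set (E n)) (w : ℕ → E n → ℝ) : Prop :=
  ∀ K : Set (E n), K ⊆ S → IsCompact K → ∃ M : ℝ, ∀ k, ∀ x ∈ K, |w k x| ≤ M

end ObliqueHJ

end

open scoped Manifold ContDiff

/-! Formally, convexity gives `H(x, ∑ λ_k Du_k) ≤ ∑ λ_k f_k`. In the viscosity sense the heart is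
the case of two subsolutions, `IsSubsolution.convex_combination`. Let `φ` touch `a u₁ + b u₂` from
above at `x₀`, with `a + b = 1`. With `θ = φ + |· - x₀|²`, maximize `a (u₁ - θ)(x) + b (u₂ - θ)(y) -
m ⟪B(x - y), x - y⟫`. The Lipschitz bounds keep `m (x - y)` bounded, so along a subsequence it tends
to some `z`. The two test gradients then tend to `Dφ(x₀) + (2/a) B z` and `Dφ(x₀) - (2/b) B z`.
Their `(a, b)`-average is `Dφ(x₀)`, so convexity of `H` concludes, provided each variable satisfies
the `H` inequality rather than the boundary one. The choice of `B` ensures this: it is symmetric,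
positive definite, and maps `γ(x₀)` to a positive multiple of the outer normal. If the first
variable lies on the boundary infinitely often, then `z` points weakly outwards, so `⟪γ, B z⟫ ≥ 0`.
The boundary inequality for `u₁` would therefore give `⟪γ, Dφ⟫ ≤ g` at `x₀`, the other admissible
conclusion. The second variable is symmetric, with `-z`. Finite combinations follow from convexity
of the set of pairs `(f, u)`. The series is the locally uniform limit of normalized partial sums,
under which subsolutions are stable. -/

namespace ObliqueHJ

variable {n : ℕ}

/-! ### Doubling of variables -/

section Doubling

variable {F : Type*} [NormedAddCommGroup F] [NormedSpace ℝ F]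

/-- Doubling of variables for two Lipschitz functions whose sum has a strict maximum, with a
quadratic penalization. -/
theorem exists_seq_isMaxOn_doubling {K : Set F} (hK : IsCompact K) {x₀ : F} (hx₀ : x₀ ∈ K)
    {w₁ w₂ q : F → ℝ} {L₁ L₂ : NNReal} (h₁ : LipschitzOnWith L₁ w₁ K)
    (h₂ : LipschitzOnWith L₂ w₂ K) (hq : Continuous q) (hq0 : q 0 = 0) {c : ℝ} (hc : 0 < c)
    (hqc : ∀ z, c * ‖z‖ ^ 2 ≤ q z)
    (hmax : ∀ x ∈ K, w₁ x + w₂ x + ‖x - x₀‖ ^ 2 ≤ w₁ x₀ + w₂ x₀) :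
    ∃ x y : ℕ → F, (∀ m, x m ∈ K) ∧ (∀ m, y m ∈ K) ∧
      Tendsto x atTop (𝓝 x₀) ∧ Tendsto y atTop (𝓝 x₀) ∧
      (∃ C : ℝ, ∀ m : ℕ, ‖(m : ℝ) • (x m - y m)‖ ≤ C) ∧
      (∀ m : ℕ, IsMaxOn (fun x' => w₁ x' - m * q (x' - y m)) K (x m)) ∧
      ∀ m : ℕ, IsMaxOn (fun y' => w₂ y' - m * q (x m - y')) K (y m) := by
  have key : ∀ m : ℕ, ∃ p ∈ K ×ˢ K,
      IsMaxOn (fun p : F × F => w₁ p.1 + w₂ p.2 - m * q (p.1 - p.2)) (K ×ˢ K) p := by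
    intro m
    refine (hK.prod hK).exists_isMaxOn ⟨(x₀, x₀), hx₀, hx₀⟩ ?_
    have e₁ := h₁.continuousOn.comp (t := K) continuousOn_fst (fun p (hp : p ∈ K ×ˢ K) => hp.1)
    have e₂ := h₂.continuousOn.comp (t := K) continuousOn_snd (fun p (hp : p ∈ K ×ˢ K) => hp.2)
    exact (e₁.add e₂).sub (by fun_prop)
  choose p hpK hp using key
  have hxK : ∀ m, (p m).1 ∈ K := fun m => (hpK m).1
  have hyK : ∀ m, (p m).2 ∈ K := fun m => (hpK m).2
  have hmx : ∀ m : ℕ, ∀ a ∈ K, ∀ b ∈ K, w₁ a + w₂ b - m * q (a - b) ≤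
      w₁ (p m).1 + w₂ (p m).2 - m * q ((p m).1 - (p m).2) :=
    fun m a ha b hb => hp m (show (a, b) ∈ K ×ˢ K from ⟨ha, hb⟩)
  have hq_nonneg : ∀ z, 0 ≤ q z := fun z => (by positivity : (0 : ℝ) ≤ c * ‖z‖ ^ 2).trans (hqc z)
  have hL₁ : ∀ m, w₁ (p m).1 - w₁ (p m).2 ≤ L₁ * ‖(p m).1 - (p m).2‖ := fun m => by
    have := h₁.dist_le_mul _ (hxK m) _ (hyK m)
    rw [Real.dist_eq, dist_eq_norm] at this
    exact (le_abs_self _).trans this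
  have hL₂ : ∀ m, w₂ (p m).2 - w₂ (p m).1 ≤ L₂ * ‖(p m).1 - (p m).2‖ := fun m => by
    have := h₂.dist_le_mul _ (hyK m) _ (hxK m)
    rw [Real.dist_eq, dist_eq_norm, norm_sub_rev] at this
    exact (le_abs_self _).trans this
  have hC : ∀ m : ℕ, m * ‖(p m).1 - (p m).2‖ ≤ L₁ / c := by
    intro m
    rcases (norm_nonneg ((p m).1 - (p m).2)).eq_or_lt with h0 | h0
    · rw [← h0]; simp; positivity
    -- Comparison with the diagonal point `(y, y)`: `m c ‖x - y‖² ≤ w₁ x - w₁ y ≤ L₁ ‖x - y‖`.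
    have h3 := hmx m _ (hyK m) _ (hyK m)
    rw [sub_self, hq0] at h3
    have h4 := mul_le_mul_of_nonneg_left (hqc ((p m).1 - (p m).2)) m.cast_nonneg (α := ℝ)
    rw [le_div_iff₀ hc]
    have h5 := hL₁ m
    refine le_of_mul_le_mul_right ?_ h0
    nlinarith
  have hdist : Tendsto (fun m => ‖(p m).1 - (p m).2‖) atTop (𝓝 0) := by
    refine squeeze_zero' (Eventually.of_forall fun m => norm_nonneg _) ?_
      (tendsto_const_div_atTop_nhds_zero_nat (L₁ / c : ℝ))
    filter_upwards [eventually_gt_atTop 0] with m hm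
    rw [le_div_iff₀ (by exact_mod_cast hm), mul_comm]
    exact hC m
  have hx : Tendsto (fun m => (p m).1) atTop (𝓝 x₀) := by
    rw [tendsto_iff_norm_sub_tendsto_zero]
    -- Comparison with `(x₀, x₀)`, after replacing `w₂ y` by `w₂ x` at the cost of `L₂ ‖x - y‖`,
    -- leaves `‖x - x₀‖² ≤ L₂ ‖x - y‖`.
    have hsq : Tendsto (fun m => ‖(p m).1 - x₀‖ ^ 2) atTop (𝓝 0) := by
      refine squeeze_zero (fun m => by positivity) (fun m => ?_)
        (by simpa using hdist.const_mul (L₂ : ℝ))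
      have h3 := hmx m _ hx₀ _ hx₀
      rw [sub_self, hq0] at h3
      have h4 := mul_nonneg m.cast_nonneg (hq_nonneg ((p m).1 - (p m).2)) (α := ℝ)
      linarith [hmax _ (hxK m), hL₂ m]
    have := hsq.sqrt
    simpa using this
  refine ⟨fun m => (p m).1, fun m => (p m).2, hxK, hyK, hx, ?_, ⟨L₁ / c, fun m => ?_⟩,
    fun m a ha => ?_, fun m b hb => ?_⟩
  · have := hx.sub (tendsto_zero_iff_norm_tendsto_zero.2 hdist)
    simpa using this
  · rw [norm_smul, Real.norm_natCast]
    exact hC m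
  · have := hmx m a ha _ (hyK m)
    simp only [mem_ofPred_eq]
    linarith
  · have := hmx m _ (hxK m) b hb
    simp only [mem_ofPred_eq]
    linarith

end Doubling

/-! ### The quadratic penalty adapted to the oblique direction -/

section Penalty

variable {F : Type*} [NormedAddCommGroup F] [InnerProductSpace ℝ F]

/-- If `⟪ν, γ⟫ > 0`, some symmetric positive definite operator maps `γ` to a positive multiple of
`ν`. -/
theorem exists_symmetric_coercive_map_eq_smul {ν γ : F} (h : 0 < inner ℝ ν γ) :
    ∃ B : F →L[ℝ] F, (∀ z w, inner ℝ (B z) w = inner ℝ z (B w)) ∧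
      (∃ c : ℝ, 0 < c ∧ ∀ z, c * ‖z‖ ^ 2 ≤ inner ℝ (B z) z) ∧ ∃ κ : ℝ, 0 < κ ∧ B γ = κ • ν := by
  set a : ℝ := inner ℝ ν γ with ha
  -- With this `d` the form of `B` is `‖z - (⟪ν, z⟫ / a) γ‖² + ⟪ν, z⟫²`. The first square is
  -- degenerate exactly along `γ`, which gives `B γ = a ν`; the second restores definiteness.
  set d : ℝ := ‖γ‖ ^ 2 / a ^ 2 + 1 with hd
  let B : F →L[ℝ] F := ContinuousLinearMap.id ℝ F - (innerSL ℝ ν).smulRight (a⁻¹ • γ)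
    - (innerSL ℝ γ).smulRight (a⁻¹ • ν) + (innerSL ℝ ν).smulRight (d • ν)
  have hB : ∀ z, B z = z - inner ℝ ν z • a⁻¹ • γ - inner ℝ γ z • a⁻¹ • ν + inner ℝ ν z • d • ν :=
    fun z => by simp [B]
  refine ⟨B, fun z w => ?_, ⟨(2 * d)⁻¹, by positivity, fun z => ?_⟩, a, h, ?_⟩
  · simp only [hB, inner_add_left, inner_sub_left, inner_add_right, inner_sub_right,
      real_inner_smul_left, real_inner_smul_right]
    rw [real_inner_comm ν z, real_inner_comm γ z]
    ring
  · have e : inner ℝ (B z) z = ‖z - (inner ℝ ν z / a) • γ‖ ^ 2 + (inner ℝ ν z) ^ 2 := by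
      rw [norm_sub_sq_real, norm_smul, mul_pow, Real.norm_eq_abs, sq_abs]
      simp only [hB, inner_add_left, inner_sub_left, real_inner_smul_left, real_inner_smul_right,
        real_inner_self_eq_norm_sq]
      rw [real_inner_comm γ z, hd]
      field_simp
      ring
    have e2 : ‖z‖ ≤ ‖z - (inner ℝ ν z / a) • γ‖ + |inner ℝ ν z| * (‖γ‖ / a) := by
      have := norm_add_le (z - (inner ℝ ν z / a) • γ) ((inner ℝ ν z / a) • γ)
      rwa [sub_add_cancel, norm_smul, Real.norm_eq_abs, abs_div, abs_of_pos h, div_mul_comm,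
        mul_comm (_ / _)] at this
    rw [e, inv_mul_le_iff₀ (by positivity)]
    set s := ‖z - (inner ℝ ν z / a) • γ‖
    set t := inner ℝ ν z
    have hd' : d = (‖γ‖ / a) ^ 2 + 1 := by rw [hd, div_pow]
    set r := ‖γ‖ / a
    have e3 : ‖z‖ ^ 2 ≤ (s + |t| * r) ^ 2 := pow_le_pow_left₀ (norm_nonneg _) e2 2
    have e4 : (|t| * r) ^ 2 = t ^ 2 * r ^ 2 := by rw [mul_pow, sq_abs]
    rw [hd']
    nlinarith [sq_nonneg (s - |t| * r), sq_nonneg (s * r), sq_nonneg t]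
  · rw [hB, ← ha, real_inner_self_eq_norm_sq, smul_smul a, mul_inv_cancel₀ h.ne', one_smul,
      sub_self, zero_sub, smul_smul, smul_smul, ← neg_smul, ← add_smul, hd]
    congr 1
    field_simp
    ring_nf

theorem hasFDerivAt_inner_map_self_sub {B : F →L[ℝ] F}
    (hB : ∀ z w, inner ℝ (B z) w = inner ℝ z (B w)) (y x : F) :
    HasFDerivAt (fun x' => inner ℝ (B (x' - y)) (x' - y)) (innerSL ℝ ((2 : ℝ) • B (x - y))) x := by
  have h1 : HasFDerivAt (fun x' : F => x' - y) (ContinuousLinearMap.id ℝ F) x :=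
    (hasFDerivAt_id x).sub_const y
  have h2 := (B.hasFDerivAt (x := x - y)).comp x h1
  have := HasFDerivAt.inner ℝ h2 h1
  refine this.congr_fderiv ?_
  ext w
  simp [fderivInnerCLM_apply, hB w, real_inner_comm w, inner_sub_right]
  ring

end Penalty

/-! ### Limits of viscosity inequalities and of boundary directions -/

section Limits

/-- Passage to the limit in the viscosity inequalities. -/
theorem viscosity_inequality_of_tendsto {ι : Type*} {l : Filter ι} [l.NeBot] {Ω : Set (E n)}
    {H : E n → E n → ℝ}
    (hH : ContinuousOn (Function.uncurry H) (closure Ω ×ˢ Set.univ)) {γ : E n → E n}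
    (hγ : ContinuousOn γ (frontier Ω)) {g : E n → ℝ} (hg : ContinuousOn g (frontier Ω))
    {x p : ι → E n} {s : ι → ℝ} {x₀ p₀ : E n} {s₀ : ℝ} (hx₀ : x₀ ∈ closure Ω)
    (hxΩ : ∀ m, x m ∈ closure Ω)
    (hx : Tendsto x l (𝓝 x₀)) (hp : Tendsto p l (𝓝 p₀)) (hs : Tendsto s l (𝓝 s₀))
    (h : ∀ᶠ m in l, H (x m) (p m) ≤ s m ∨ x m ∈ frontier Ω ∧ inner ℝ (γ (x m)) (p m) ≤ g (x m)) :
    H x₀ p₀ ≤ s₀ ∨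
      (∃ᶠ m in l, x m ∈ frontier Ω) ∧ x₀ ∈ frontier Ω ∧ inner ℝ (γ x₀) p₀ ≤ g x₀ := by
  -- Either the `H` inequality holds frequently, which suffices for the limit, or the boundary
  -- alternative holds eventually.
  by_cases hf : ∃ᶠ m in l, H (x m) (p m) ≤ s m
  · left
    have hHt : Tendsto (fun m => H (x m) (p m)) l (𝓝 (H x₀ p₀)) := by
      refine (hH (x₀, p₀) ⟨hx₀, mem_univ _⟩).tendsto.comp
        (tendsto_nhdsWithin_iff.2 ⟨hx.prodMk_nhds hp, Eventually.of_forall fun m => ?_⟩)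
      exact ⟨hxΩ m, mem_univ _⟩
    have := le_of_tendsto_of_frequently (hHt.sub hs) (b := 0) (hf.mono fun m hm => by linarith)
    linarith
  · right
    have hev : ∀ᶠ m in l, x m ∈ frontier Ω ∧ inner ℝ (γ (x m)) (p m) ≤ g (x m) := by
      filter_upwards [h, not_frequently.1 hf] with m h1 h2 using h1.resolve_left h2
    have hx₀f : x₀ ∈ frontier Ω :=
      isClosed_frontier.mem_of_tendsto hx (hev.mono fun m hm => hm.1)
    have hxf : Tendsto x l (𝓝[frontier Ω] x₀) :=
      tendsto_nhdsWithin_iff.2 ⟨hx, hev.mono fun m hm => hm.1⟩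
    refine ⟨(hev.mono fun m hm => hm.1).frequently, hx₀f, ?_⟩
    exact le_of_tendsto_of_tendsto (((hγ x₀ hx₀f).tendsto.comp hxf).inner hp)
      ((hg x₀ hx₀f).tendsto.comp hxf) (hev.mono fun m hm => hm.2)

theorem IsLocalDefiningFunction.nonpos {Ω W : Set (E n)} {ρ : E n → ℝ}
    (h : IsLocalDefiningFunction Ω W ρ) {y : E n} (hyW : y ∈ W) (hy : y ∈ closure Ω) :
    ρ y ≤ 0 := by
  have hc : ContinuousAt ρ y := h.contDiffOn.continuousOn.continuousAt (h.isOpen.mem_nhds hyW)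
  refine le_of_tendsto_of_frequently hc ?_
  refine ((mem_closure_iff_frequently.1 hy).and_eventually (h.isOpen.mem_nhds hyW)).mono ?_
  rintro z ⟨hz, hzW⟩
  have : z ∈ Ω ∩ W := ⟨hz, hzW⟩
  rw [h.inter_eq] at this
  exact this.2.le

/-- Limits of rescaled differences `x m - y m`, with `x m` on the boundary and `y m` in the closed
domain, point outwards. -/
theorem IsLocalDefiningFunction.inner_gradient_nonneg {ι : Type*} {l : Filter ι}
    {Ω W : Set (E n)} (hΩ : IsOpen Ω) {ρ : E n → ℝ} (h : IsLocalDefiningFunction Ω W ρ)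
    {x₀ z : E n} (hx₀ : x₀ ∈ W) {x y : ι → E n} {t : ι → ℝ} (ht : ∀ m, 0 ≤ t m)
    (hx : Tendsto x l (𝓝 x₀)) (hy : Tendsto y l (𝓝 x₀))
    (hxf : ∃ᶠ m in l, x m ∈ frontier Ω) (hyΩ : ∀ m, y m ∈ closure Ω)
    (hz : Tendsto (fun m => t m • (x m - y m)) l (𝓝 z)) :
    0 ≤ inner ℝ (gradient ρ x₀) z := by
  have hW := h.isOpen.mem_nhds hx₀
  -- Strict differentiability is needed because both `x m` and `y m` move.
  have hd : HasStrictFDerivAt ρ (fderiv ℝ ρ x₀) x₀ :=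
    (h.contDiffOn.contDiffAt hW).hasStrictFDerivAt one_ne_zero
  rw [inner_gradient_left]
  -- The expression equals `t m * (ρ (x m) - ρ (y m))`, whose sign is known on the boundary. The
  -- linearization error vanishes because `t m * ‖x m - y m‖` is bounded.
  have hlim : Tendsto (fun m => fderiv ℝ ρ x₀ (t m • (x m - y m))
      - t m * (fderiv ℝ ρ x₀ (x m - y m) - (ρ (x m) - ρ (y m)))) l (𝓝 (fderiv ℝ ρ x₀ z - 0)) := by
    refine ((fderiv ℝ ρ x₀).continuous.tendsto z |>.comp hz).sub ?_
    have ho : (fun m => t m * (fderiv ℝ ρ x₀ (x m - y m) - (ρ (x m) - ρ (y m)))) =o[l]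
        fun m => t m * ‖x m - y m‖ := by
      refine (Asymptotics.isBigO_refl t l).mul_isLittleO ?_
      refine Asymptotics.IsLittleO.norm_right ?_
      have := (hd.isLittleO.comp_tendsto (hx.prodMk_nhds hy)).neg_left
      refine this.congr_left fun m => ?_
      simp
    refine (ho.trans_isBigO (?_ : _ =O[l] fun _ => (1 : ℝ))).tendsto_zero_of_tendsto
      tendsto_const_nhds
    refine ((hz.isBigO_one ℝ).norm_left).congr_left fun m => ?_
    rw [norm_smul, Real.norm_of_nonneg (ht m)]
  rw [sub_zero] at hlim
  refine ge_of_tendsto_of_frequently hlim ((hxf.and_eventually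
    ((hx.eventually hW).and (hy.eventually hW))).mono ?_)
  rintro m ⟨hm, hxW, hyW⟩
  have h1 : 0 ≤ ρ (x m) := by
    by_contra hneg
    have : x m ∈ Ω ∩ W := by rw [h.inter_eq]; exact ⟨hxW, not_le.1 hneg⟩
    rw [hΩ.frontier_eq] at hm
    exact hm.2 this.1
  have h2 := h.nonpos hyW (hyΩ m)
  rw [map_smul, smul_eq_mul]
  nlinarith [ht m]

end Limits

/-! ### Test functions: from local to global maxima -/

theorem uscEnvelope_eq_of_continuousOn {S : Set (E n)} {w : E n → ℝ} (hw : ContinuousOn w S)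
    {x : E n} (hx : x ∈ S) : uscEnvelope S w x = w x := by
  have : (𝓝[S] x).NeBot := mem_closure_iff_nhdsWithin_neBot.1 (subset_closure hx)
  exact (hw x hx).tendsto.limsup_eq

theorem locallyBoundedAboveOn_of_continuousOn {S : Set (E n)} {w : E n → ℝ}
    (hw : ContinuousOn w S) : LocallyBoundedAboveOn S w := fun x hx =>
  ⟨w x + 1, ((hw x hx).tendsto.eventually_lt_const (lt_add_one _)).mono fun _ h => h.le⟩

/-- A nonnegative `C¹` function on `U` that vanishes at `x` and dominates on `U ∩ C` a continuous
function which is nonpositive near `x`. -/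
theorem exists_contDiffOn_ge {U C : Set (E n)} (hU : IsOpen U) (hC : IsClosed C) {d : E n → ℝ}
    (hd : ContinuousOn d (U ∩ C)) {x : E n} (hdx : ∀ᶠ y in 𝓝[U ∩ C] x, d y ≤ 0) :
    ∃ χ : E n → ℝ, ContDiffOn ℝ 1 χ U ∧ (x ∈ U → χ x = 0) ∧ (∀ y ∈ U, 0 ≤ χ y) ∧
      ∀ y ∈ U ∩ C, y ≠ x → d y ≤ χ y := by
  classical
  let O : TopologicalSpace.Opens (E n) := ⟨U, hU⟩
  have : LocallyCompactSpace O := hU.locallyCompactSpace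
  -- All requirements on `χ y` cut out a convex set of values, and locally a constant meets them. A
  -- smooth partition of unity then glues the constants.
  let t : O → Set ℝ := fun y => {c | 0 ≤ c ∧ (y.1 = x → c ≤ 0) ∧ (y.1 ∈ C → y.1 ≠ x → d y ≤ c)}
  have ht : ∀ y, Convex ℝ (t y) := by
    intro y
    have e : t y = Ici 0 ∩ ({c | y.1 = x → c ≤ 0} ∩ {c | y.1 ∈ C → y.1 ≠ x → d y ≤ c}) := rfl
    rw [e]
    refine (convex_Ici 0).inter (Convex.inter ?_ ?_)
    · by_cases h : y.1 = x
      · simpa [h] using! convex_Iic (0 : ℝ)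
      · simpa [h] using convex_univ
    · by_cases h : y.1 ∈ C ∧ y.1 ≠ x
      · simpa [h.1, h.2] using! convex_Ici (d y)
      · have : {c : ℝ | y.1 ∈ C → y.1 ≠ x → d y ≤ c} = univ :=
          eq_univ_of_forall fun c h1 h2 => absurd ⟨h1, h2⟩ h
        rw [this]
        exact convex_univ
  have hloc : ∀ y : O, ∃ c : ℝ, ∀ᶠ z in 𝓝 y, c ∈ t z := by
    intro y
    have hcoe : Tendsto (Subtype.val : O → E n) (𝓝 y) (𝓝 y.1) := continuous_subtype_val.continuousAt
    by_cases hyx : y.1 = x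
    · refine ⟨0, ?_⟩
      rw [← hyx, eventually_nhdsWithin_iff] at hdx
      filter_upwards [hcoe.eventually hdx] with z hz
      exact ⟨le_rfl, fun _ => le_rfl, fun h _ => hz ⟨z.2, h⟩⟩
    by_cases hyC : y.1 ∈ C
    · refine ⟨max 0 (d y + 1), ?_⟩
      have h1 := (hd y ⟨y.2, hyC⟩).tendsto.eventually_lt_const (lt_add_one (d y))
      rw [eventually_nhdsWithin_iff] at h1
      filter_upwards [hcoe.eventually h1, hcoe.eventually_ne hyx] with z hz hzx
      exact ⟨le_max_left _ _, fun h => absurd h hzx,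
        fun h _ => (hz ⟨z.2, h⟩).le.trans (le_max_right _ _)⟩
    · refine ⟨0, ?_⟩
      filter_upwards [hcoe.eventually (hC.isOpen_compl.mem_nhds hyC)] with z hz
      exact ⟨le_rfl, fun _ => le_rfl, fun h => absurd h hz⟩
  obtain ⟨χ, hχ⟩ := exists_contMDiffMap_forall_mem_convex_of_local_const (n := ⊤) 𝓘(ℝ, E n) ht hloc
  have hext : ∀ y : O, Function.extend Subtype.val χ 0 y.1 = χ y :=
    fun y => Subtype.val_injective.extend_apply _ _ y
  refine ⟨Function.extend Subtype.val χ 0, fun y hy => ?_, fun hx => ?_, fun y hy => ?_,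
    fun y hy hyx => ?_⟩
  · have h1 : ContMDiffAt 𝓘(ℝ, E n) 𝓘(ℝ, ℝ) ∞
        (fun z : O => Function.extend Subtype.val χ 0 z.1) ⟨y, hy⟩ := by
      simp only [hext]
      exact χ.contMDiff.contMDiffAt
    rw [contMDiffAt_subtype_iff, contMDiffAt_iff_contDiffAt] at h1
    exact (h1.of_le (by exact_mod_cast le_top)).contDiffWithinAt
  · have := hχ ⟨x, hx⟩
    rw [hext ⟨x, hx⟩]
    exact le_antisymm (this.2.1 rfl) this.1
  · rw [hext ⟨y, hy⟩]
    exact (hχ _).1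
  · rw [hext ⟨y, hy.1⟩]
    exact (hχ ⟨y, hy.1⟩).2.2 hy.2 hyx

section

variable {Ω U : Set (E n)} {H : E n → E n → ℝ} {γ : E n → E n} {g f u : E n → ℝ}

/-- The subsolution inequalities hold at local maxima. -/
theorem IsSubsolution.of_isLocalMaxOn (h : IsSubsolution Ω U H γ g f u) (hΩ : IsOpen Ω)
    (hU : IsOpen U) (hu : ContinuousOn u (U ∩ closure Ω)) {φ : E n → ℝ} (hφ : ContDiffOn ℝ 1 φ U)
    {x : E n} (hx : x ∈ U ∩ closure Ω)
    (hmax : IsLocalMaxOn (fun y => u y - φ y) (U ∩ closure Ω) x) :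
    H x (gradient φ x) ≤ f x ∨ x ∈ frontier Ω ∧ inner ℝ (γ x) (gradient φ x) ≤ g x := by
  obtain ⟨χ, hχ, hχx, hχ0, hχd⟩ := exists_contDiffOn_ge hU (isClosed_closure (s := Ω))
    (d := fun y => (u y - φ y) - (u x - φ x)) ((hu.sub (hφ.continuousOn.mono inter_subset_left)).sub
      continuousOn_const) (x := x) (hmax.mono fun y hy => sub_nonpos.2 hy)
  have hχx0 := hχx hx.1
  have hUx := hU.mem_nhds hx.1
  -- The correction `χ` has a minimum at `x`, so adding it makes the maximum global without changing
  -- the test gradient.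
  have hd0 : fderiv ℝ χ x = 0 := by
    refine IsLocalMin.fderiv_eq_zero ?_
    filter_upwards [hUx] with y hy
    rw [hχx0]
    exact hχ0 y hy
  have hgrad : gradient (fun y => φ y + χ y) x = gradient φ x := by
    unfold gradient
    rw [fderiv_fun_add ((hφ.contDiffAt hUx).differentiableAt one_ne_zero)
      ((hχ.contDiffAt hUx).differentiableAt one_ne_zero), hd0, add_zero]
  have hmax' : IsMaxOn (fun y => uscEnvelope (U ∩ closure Ω) u y - (φ y + χ y)) (U ∩ closure Ω)
      x := by
    intro y hy
    simp only [mem_ofPred_eq, uscEnvelope_eq_of_continuousOn hu hy,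
      uscEnvelope_eq_of_continuousOn hu hx, hχx0]
    by_cases hyx : y = x
    · rw [hyx, hχx0]
    · linarith [hχd y hy hyx]
  have hcd := hφ.add hχ
  rw [← hgrad]
  by_cases hxΩ : x ∈ Ω
  · exact Or.inl (h.interior_ineq _ hcd x ⟨hx.1, hxΩ⟩ hmax')
  · have hxf : x ∈ frontier Ω := by
      rw [hΩ.frontier_eq]
      exact ⟨hx.2, hxΩ⟩
    exact (h.boundary_ineq _ hcd x ⟨hx.1, hxf⟩ hmax').imp id fun h => ⟨hxf, h⟩

/-- For a continuous function, no semicontinuous envelope is needed in the definition. -/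
theorem isSubsolution_of_continuousOn (hu : ContinuousOn u (U ∩ closure Ω))
    (h : ∀ φ : E n → ℝ, ContDiffOn ℝ 1 φ U → ∀ x ∈ U ∩ closure Ω,
      (∀ y ∈ U ∩ closure Ω, u y - φ y ≤ u x - φ x) →
      H x (gradient φ x) ≤ f x ∨ x ∈ frontier Ω ∧ inner ℝ (γ x) (gradient φ x) ≤ g x)
    (hΩ : IsOpen Ω) :
    IsSubsolution Ω U H γ g f u := by
  have hmax : ∀ φ : E n → ℝ, ∀ x ∈ U ∩ closure Ω,
      IsMaxOn (fun y => uscEnvelope (U ∩ closure Ω) u y - φ y) (U ∩ closure Ω) x →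
      ∀ y ∈ U ∩ closure Ω, u y - φ y ≤ u x - φ x := by
    intro φ x hx hm y hy
    have := hm hy
    simpa only [mem_ofPred_eq, uscEnvelope_eq_of_continuousOn hu hy,
      uscEnvelope_eq_of_continuousOn hu hx] using this
  refine ⟨locallyBoundedAboveOn_of_continuousOn hu, fun φ hφ x hx hm => ?_,
    fun φ hφ x hx hm => ?_⟩
  · have hx' : x ∈ U ∩ closure Ω := ⟨hx.1, subset_closure hx.2⟩
    refine (h φ hφ x hx' (hmax φ x hx' hm)).resolve_right fun hxf => ?_
    have := hxf.1
    rw [hΩ.frontier_eq] at this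
    exact this.2 hx.2
  · have hx' : x ∈ U ∩ closure Ω := ⟨hx.1, frontier_subset_closure hx.2⟩
    exact (h φ hφ x hx' (hmax φ x hx' hm)).imp id And.right

theorem exists_closedBall_inter_subset (hU : IsOpen U) {x : E n} (hx : x ∈ U) {t : Set (E n)}
    (ht : t ∈ 𝓝[U ∩ closure Ω] x) :
    ∃ r > 0, Metric.closedBall x r ∩ closure Ω ⊆ t ∩ (U ∩ closure Ω) := by
  obtain ⟨s, hs, hst⟩ := mem_nhdsWithin_iff_exists_mem_nhds_inter.1 ht
  obtain ⟨r, hr, hrs⟩ := Metric.nhds_basis_closedBall.mem_iff.1 (inter_mem hs (hU.mem_nhds hx))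
  exact ⟨r, hr, fun y hy => ⟨hst ⟨(hrs hy.1).1, (hrs hy.1).2, hy.2⟩, (hrs hy.1).2, hy.2⟩⟩

/-- A maximum over a small closed ball, attained inside the ball, is a local maximum. -/
theorem isLocalMaxOn_of_isMaxOn_closedBall_inter {x₀ x : E n} {r : ℝ} {w : E n → ℝ}
    (hx : x ∈ Metric.ball x₀ r) (h : IsMaxOn w (Metric.closedBall x₀ r ∩ closure Ω) x) :
    IsLocalMaxOn w (U ∩ closure Ω) x := by
  filter_upwards [self_mem_nhdsWithin, mem_nhdsWithin_of_mem_nhds (Metric.isOpen_ball.mem_nhds hx)]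
    with y hy hyb using h ⟨Metric.ball_subset_closedBall hyb, hy.2⟩

theorem gradient_eq_of_hasFDerivAt {φ : E n → ℝ} {v x : E n}
    (h : HasFDerivAt φ (innerSL ℝ v) x) : gradient φ x = v := by
  exact HasGradientAt.gradient (hasGradientAt_iff_hasFDerivAt.2 h)

theorem ContDiffOn.hasFDerivAt_gradient {φ : E n → ℝ} (hU : IsOpen U) (hφ : ContDiffOn ℝ 1 φ U)
    {x : E n} (hx : x ∈ U) : HasFDerivAt φ (innerSL ℝ (gradient φ x)) x := by
  have := ((hφ.contDiffAt (hU.mem_nhds hx)).differentiableAt one_ne_zero).hasGradientAt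
  exact hasGradientAt_iff_hasFDerivAt.1 this

theorem ContDiffOn.continuousAt_gradient {φ : E n → ℝ} (hU : IsOpen U) (hφ : ContDiffOn ℝ 1 φ U)
    {x : E n} (hx : x ∈ U) : ContinuousAt (gradient φ) x :=
  ((InnerProductSpace.toDual ℝ (E n)).symm.continuous.continuousAt).comp
    ((hφ.continuousOn_fderiv_of_isOpen hU le_rfl).continuousAt (hU.mem_nhds hx))

theorem hasFDerivAt_norm_sub_sq (x₀ x : E n) :
    HasFDerivAt (fun y => ‖y - x₀‖ ^ 2) (innerSL ℝ ((2 : ℝ) • (x - x₀))) x := by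
  have := ((hasFDerivAt_id x).sub_const x₀).norm_sq
  refine this.congr_fderiv ?_
  ext w
  simp

theorem contDiff_norm_sub_sq (x₀ : E n) : ContDiff ℝ 1 fun y : E n => ‖y - x₀‖ ^ 2 :=
  (contDiff_id.sub contDiff_const).norm_sq ℝ

end

/-! ### Convex combinations and stability of subsolutions -/

section

variable {Ω U : Set (E n)} {H : E n → E n → ℝ} {γ : E n → E n} {g f u : E n → ℝ}

/-- The subsolution inequality for one of the variables, after doubling of variables. -/
theorem IsSubsolution.of_isMaxOn_penalized (h : IsSubsolution Ω U H γ g f u) (hΩ : IsOpen Ω)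
    (hU : IsOpen U) (hu : ContinuousOn u (U ∩ closure Ω)) {φ : E n → ℝ} (hφ : ContDiffOn ℝ 1 φ U)
    {B : E n →L[ℝ] E n} (hB : ∀ z w, inner ℝ (B z) w = inner ℝ z (B w))
    {a t r : ℝ} (ha : 0 < a) {x₀ x y : E n} (hxU : x ∈ U ∩ closure Ω)
    (hx : x ∈ Metric.ball x₀ r)
    (hmax : IsMaxOn (fun x' => a * (u x' - (φ x' + ‖x' - x₀‖ ^ 2))
      - t * inner ℝ (B (x' - y)) (x' - y)) (Metric.closedBall x₀ r ∩ closure Ω) x) :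
    let p := gradient φ x + (2 : ℝ) • (x - x₀) + (2 / a) • B (t • (x - y))
    H x p ≤ f x ∨ x ∈ frontier Ω ∧ inner ℝ (γ x) p ≤ g x := by
  intro p
  let ψ : E n → ℝ := fun x' =>
    φ x' + ‖x' - x₀‖ ^ 2 + t / a * inner ℝ (B (x' - y)) (x' - y)
  have hψ : ContDiffOn ℝ 1 ψ U := by
    refine (hφ.add (contDiff_norm_sub_sq x₀).contDiffOn).add (ContDiff.contDiffOn ?_)
    have h1 : ContDiff ℝ 1 fun x' : E n => x' - y := contDiff_id.sub contDiff_const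
    exact contDiff_const.mul ((B.contDiff.comp h1).inner ℝ h1)
  have hgrad : gradient ψ x = p := by
    refine gradient_eq_of_hasFDerivAt ?_
    refine (((ContDiffOn.hasFDerivAt_gradient hU hφ hxU.1).add
      (hasFDerivAt_norm_sub_sq x₀ x)).add
      ((hasFDerivAt_inner_map_self_sub hB y x).const_mul (t / a))).congr_fderiv ?_
    simp only [p, map_add, map_smul, smul_smul]
    congr 2
    ring
  have hloc : IsLocalMaxOn (fun x' => u x' - ψ x') (U ∩ closure Ω) x := by
    refine (isLocalMaxOn_of_isMaxOn_closedBall_inter hx hmax).mono fun x' hx' => ?_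
    have e : ∀ s : E n, a * (u s - (φ s + ‖s - x₀‖ ^ 2)) - t * inner ℝ (B (s - y)) (s - y)
        = a * (u s - ψ s) := by
      intro s
      simp only [ψ]
      field_simp
      ring
    beta_reduce at hx'
    rw [e, e] at hx'
    exact le_of_mul_le_mul_left hx' ha
  rw [← hgrad]
  exact h.of_isLocalMaxOn hΩ hU hu hψ hxU hloc

/-- Limit of the inequality for one of the variables, when the penalization is adapted to the
oblique direction. -/
theorem IsSubsolution.le_of_tendsto_penalized (h : IsSubsolution Ω U H γ g f u) (hΩ : IsOpen Ω)
    (hU : IsOpen U) (hH : ContinuousOn (Function.uncurry H) (closure Ω ×ˢ Set.univ))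
    (hγ : ContinuousOn γ (frontier Ω)) (hg : ContinuousOn g (frontier Ω))
    (hf : ContinuousOn f (U ∩ closure Ω))
    (hu : ContinuousOn u (U ∩ closure Ω)) {φ : E n → ℝ} (hφ : ContDiffOn ℝ 1 φ U)
    {B : E n →L[ℝ] E n} (hB : ∀ z w, inner ℝ (B z) w = inner ℝ z (B w))
    {x₀ z : E n} (hx₀ : x₀ ∈ U ∩ closure Ω)
    (hBγ : x₀ ∈ frontier Ω → ∃ (W : Set (E n)) (ρ : E n → ℝ), x₀ ∈ W ∧
      IsLocalDefiningFunction Ω W ρ ∧ ∃ κ : ℝ, 0 < κ ∧ B (γ x₀) = κ • gradient ρ x₀)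
    (hnot : ¬(x₀ ∈ frontier Ω ∧ inner ℝ (γ x₀) (gradient φ x₀) ≤ g x₀))
    {a r : ℝ} (ha : 0 < a) (hr : 0 < r)
    (hrU : Metric.closedBall x₀ r ∩ closure Ω ⊆ U ∩ closure Ω)
    {x y : ℕ → E n} {t : ℕ → ℝ} (ht : ∀ m, 0 ≤ t m)
    (hxK : ∀ m, x m ∈ Metric.closedBall x₀ r ∩ closure Ω) (hy : ∀ m, y m ∈ closure Ω)
    (hx : Tendsto x atTop (𝓝 x₀)) (hyt : Tendsto y atTop (𝓝 x₀))
    (hz : Tendsto (fun m => t m • (x m - y m)) atTop (𝓝 z))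
    (hmax : ∀ m, IsMaxOn (fun x' => a * (u x' - (φ x' + ‖x' - x₀‖ ^ 2))
      - t m * inner ℝ (B (x' - y m)) (x' - y m)) (Metric.closedBall x₀ r ∩ closure Ω) (x m)) :
    H x₀ (gradient φ x₀ + (2 / a) • B z) ≤ f x₀ := by
  have hp : Tendsto (fun m => gradient φ (x m) + (2 : ℝ) • (x m - x₀)
      + (2 / a) • B (t m • (x m - y m))) atTop (𝓝 (gradient φ x₀ + (2 / a) • B z)) := by
    have h1 : Tendsto (fun m => (2 : ℝ) • (x m - x₀)) atTop (𝓝 0) := by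
      simpa using (hx.sub_const x₀).const_smul (2 : ℝ)
    have h2 := ((ContDiffOn.continuousAt_gradient hU hφ hx₀.1).tendsto.comp hx).add h1
    rw [add_zero] at h2
    exact h2.add (((B.continuous.tendsto z).comp hz).const_smul _)
  have hfx : Tendsto (fun m => f (x m)) atTop (𝓝 (f x₀)) :=
    (hf x₀ hx₀).tendsto.comp
      (tendsto_nhdsWithin_iff.2 ⟨hx, Eventually.of_forall fun m => hrU (hxK m)⟩)
  refine (viscosity_inequality_of_tendsto hH hγ hg hx₀.2 (fun m => (hxK m).2) hx hp hfx ?_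
    ).resolve_right ?_
  · filter_upwards [hx.eventually (Metric.ball_mem_nhds x₀ hr)] with m hm
    exact h.of_isMaxOn_penalized hΩ hU hu hφ hB ha (hrU (hxK m)) hm (hmax m)
  · rintro ⟨hfreq, hx₀f, hle⟩
    obtain ⟨W, ρ, hx₀W, hρ, κ, hκ, hBκ⟩ := hBγ hx₀f
    have hnn := hρ.inner_gradient_nonneg hΩ hx₀W ht hx hyt hfreq hy hz
    -- By symmetry of `B`, the penalty contributes `(2 / a) κ ⟪∇ρ(x₀), z⟫ ≥ 0` to the oblique
    -- derivative, so dropping it preserves the upper bound `g x₀`.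
    refine hnot ⟨hx₀f, le_trans ?_ hle⟩
    rw [inner_add_right, real_inner_smul_right, ← hB, hBκ, real_inner_smul_left]
    have : 0 ≤ 2 / a * (κ * inner ℝ (gradient ρ x₀) z) := by positivity
    linarith

/-- The operator is frozen at `x₀`, since the boundary inequality is only used in the limit. Away
from the boundary the identity serves. -/
theorem exists_adapted_penalty (hΩ_C1 : HasC1Boundary Ω) (hγ_oblique : IsOblique Ω γ) (x₀ : E n) :
    ∃ B : E n →L[ℝ] E n, (∀ z w, inner ℝ (B z) w = inner ℝ z (B w)) ∧
      (∃ c : ℝ, 0 < c ∧ ∀ z, c * ‖z‖ ^ 2 ≤ inner ℝ (B z) z) ∧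
      (x₀ ∈ frontier Ω → ∃ (W : Set (E n)) (ρ : E n → ℝ), x₀ ∈ W ∧
        IsLocalDefiningFunction Ω W ρ ∧ ∃ κ : ℝ, 0 < κ ∧ B (γ x₀) = κ • gradient ρ x₀) := by
  by_cases hx₀ : x₀ ∈ frontier Ω
  · obtain ⟨W, ρ, hW, hρ⟩ := hΩ_C1 x₀ hx₀
    have h1 := hγ_oblique x₀ hx₀ _ ⟨W, ρ, hW, hρ, rfl⟩
    rw [real_inner_smul_left] at h1
    have h2 : 0 < inner ℝ (gradient ρ x₀) (γ x₀) :=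
      pos_of_mul_pos_right h1 (inv_nonneg.2 (norm_nonneg _))
    obtain ⟨B, hB, hc, hκ⟩ := exists_symmetric_coercive_map_eq_smul h2
    exact ⟨B, hB, hc, fun _ => ⟨W, ρ, hW, hρ, hκ⟩⟩
  · exact ⟨ContinuousLinearMap.id ℝ _, fun _ _ => rfl,
      ⟨1, one_pos, fun z => by simp⟩, fun h => absurd h hx₀⟩

theorem _root_.LipschitzOnWith.const_mul_real {F : Type*} [PseudoMetricSpace F] {w : F → ℝ}
    {K : NNReal} {s : Set F} (hw : LipschitzOnWith K w s) (a : ℝ) :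
    LipschitzOnWith (‖a‖₊ * K) (fun x => a * w x) s :=
  (lipschitzWith_smul a).comp_lipschitzOnWith hw

theorem _root_.LocallyLipschitzOn.const_mul_real {F : Type*} [PseudoMetricSpace F] {w : F → ℝ}
    {s : Set F} (hw : LocallyLipschitzOn s w) (a : ℝ) :
    LocallyLipschitzOn s (fun x => a * w x) := fun x hx => by
  obtain ⟨K, t, ht, hK⟩ := hw hx
  exact ⟨_, t, ht, hK.const_mul_real a⟩

/-- Convex combinations of two locally Lipschitz subsolutions are subsolutions. -/
theorem IsSubsolution.convex_combination (hΩ : IsOpen Ω) (hΩ_C1 : HasC1Boundary Ω)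
    (hH : ContinuousOn (Function.uncurry H) (closure Ω ×ˢ Set.univ))
    (hH_convex : ∀ x ∈ closure Ω, ConvexOn ℝ Set.univ (H x))
    (hγ : ContinuousOn γ (frontier Ω)) (hγ_oblique : IsOblique Ω γ)
    (hg : ContinuousOn g (frontier Ω)) (hU : IsOpen U) {f₁ f₂ u₁ u₂ : E n → ℝ}
    (hf₁ : ContinuousOn f₁ (U ∩ closure Ω)) (hf₂ : ContinuousOn f₂ (U ∩ closure Ω))
    (hu₁ : LocallyLipschitzOn (U ∩ closure Ω) u₁) (hu₂ : LocallyLipschitzOn (U ∩ closure Ω) u₂)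
    (h₁ : IsSubsolution Ω U H γ g f₁ u₁) (h₂ : IsSubsolution Ω U H γ g f₂ u₂)
    {a b : ℝ} (ha : 0 < a) (hb : 0 < b) (hab : a + b = 1) :
    IsSubsolution Ω U H γ g (fun x => a * f₁ x + b * f₂ x) (fun x => a * u₁ x + b * u₂ x) := by
  refine isSubsolution_of_continuousOn ((hu₁.continuousOn.const_mul a).add
    (hu₂.continuousOn.const_mul b)) (fun φ hφ x₀ hx₀ hmax => ?_) hΩ
  rw [or_iff_not_imp_right]
  intro hnot
  obtain ⟨B, hB, ⟨c, hc, hBc⟩, hBγ⟩ := exists_adapted_penalty hΩ_C1 hγ_oblique x₀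
  have hθ : ContDiffAt ℝ 1 (fun x => φ x + ‖x - x₀‖ ^ 2) x₀ :=
    (hφ.contDiffAt (hU.mem_nhds hx₀.1)).add (contDiff_norm_sub_sq x₀).contDiffAt
  obtain ⟨L, s, hs, hL⟩ := hθ.exists_lipschitzOnWith
  obtain ⟨L₁, s₁, hs₁, hL₁⟩ := hu₁ hx₀
  obtain ⟨L₂, s₂, hs₂, hL₂⟩ := hu₂ hx₀
  obtain ⟨r, hr, hrs⟩ := exists_closedBall_inter_subset hU hx₀.1
    (inter_mem (mem_nhdsWithin_of_mem_nhds hs) (inter_mem hs₁ hs₂))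
  have hrU : Metric.closedBall x₀ r ∩ closure Ω ⊆ U ∩ closure Ω := fun y hy => (hrs hy).2
  set K := Metric.closedBall x₀ r ∩ closure Ω with hK
  have hKc : IsCompact K := (isCompact_closedBall x₀ r).inter_right isClosed_closure
  have hw₁ := ((hL₁.mono fun y (hy : y ∈ K) => (hrs hy).1.2.1).sub
    (hL.mono fun y (hy : y ∈ K) => (hrs hy).1.1)).const_mul_real a
  have hw₂ := ((hL₂.mono fun y (hy : y ∈ K) => (hrs hy).1.2.2).sub
    (hL.mono fun y (hy : y ∈ K) => (hrs hy).1.1)).const_mul_real b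
  obtain ⟨x, y, hxK, hyK, hx, hy, ⟨C, hC⟩, hmx, hmy⟩ := exists_seq_isMaxOn_doubling hKc
    (x₀ := x₀) ⟨Metric.mem_closedBall_self hr.le, hx₀.2⟩ hw₁ hw₂
    (q := fun z => inner ℝ (B z) z) (B.continuous.inner continuous_id) (by simp) hc hBc (by
      intro x hx
      have h1 := hmax x (hrU hx)
      simp only [sub_self, norm_zero]
      have e : ∀ s, a * s + b * s = s := fun s => by rw [← add_mul, hab, one_mul]
      linarith [e (φ x), e (φ x₀), e (‖x - x₀‖ ^ 2)])
  obtain ⟨z, -, σ, hσ, hz⟩ := tendsto_subseq_of_bounded (Metric.isBounded_closedBall (x := (0 : E n))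
    (r := C)) (x := fun m : ℕ => (m : ℝ) • (x m - y m)) (fun m => by simpa using hC m)
  have hx' := hx.comp hσ.tendsto_atTop
  have hy' := hy.comp hσ.tendsto_atTop
  have hP := h₁.le_of_tendsto_penalized hΩ hU hH hγ hg hf₁ hu₁.continuousOn hφ hB hx₀ hBγ hnot ha hr
    hrU (t := fun m => σ m) (fun m => Nat.cast_nonneg _) (fun m => hxK (σ m))
    (fun m => (hyK (σ m)).2) hx' hy' hz (fun m => hmx (σ m))
  -- The roles of `x` and `y` are exchanged; the penalty is even, and the rescaled difference tends
  -- to `-z`.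
  have hQ := h₂.le_of_tendsto_penalized hΩ hU hH hγ hg hf₂ hu₂.continuousOn hφ hB (z := -z) hx₀ hBγ
    hnot hb hr hrU (t := fun m => σ m) (fun m => Nat.cast_nonneg _) (fun m => hyK (σ m))
    (fun m => (hxK (σ m)).2) hy' hx'
    (hz.neg.congr fun m => by
      simp only [Function.comp_apply]
      rw [← smul_neg, neg_sub])
    (fun m => by
      have e : ∀ y', inner ℝ (B (x (σ m) - y')) (x (σ m) - y')
          = inner ℝ (B (y' - x (σ m))) (y' - x (σ m)) := fun y' => by
        rw [← neg_sub, map_neg, inner_neg_neg]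
      simpa only [e] using hmy (σ m))
  have hconv := (hH_convex x₀ hx₀.2).2 (mem_univ (gradient φ x₀ + (2 / a) • B z))
    (mem_univ (gradient φ x₀ + (2 / b) • B (-z))) ha.le hb.le hab
  have e : a • (gradient φ x₀ + (2 / a) • B z) + b • (gradient φ x₀ + (2 / b) • B (-z))
      = gradient φ x₀ := by
    rw [smul_add, smul_add, smul_smul, smul_smul, mul_div_cancel₀ _ ha.ne', mul_div_cancel₀ _ hb.ne',
      map_neg, smul_neg, add_add_add_comm, add_neg_cancel, add_zero, ← add_smul, hab, one_smul]
  rw [e] at hconv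
  refine hconv.trans ?_
  simp only [smul_eq_mul]
  gcongr

/-- Stability of subsolutions under locally uniform convergence. -/
theorem isSubsolution_of_tendstoLocallyUniformlyOn (hΩ : IsOpen Ω)
    (hH : ContinuousOn (Function.uncurry H) (closure Ω ×ˢ Set.univ))
    (hγ : ContinuousOn γ (frontier Ω)) (hg : ContinuousOn g (frontier Ω)) (hU : IsOpen U)
    {F v : ℕ → E n → ℝ} (hv : ∀ N, ContinuousOn (v N) (U ∩ closure Ω))
    (hf : ContinuousOn f (U ∩ closure Ω)) (hu : ContinuousOn u (U ∩ closure Ω))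
    (hsub : ∀ N, IsSubsolution Ω U H γ g (F N) (v N))
    (hvu : TendstoLocallyUniformlyOn v u atTop (U ∩ closure Ω))
    (hFf : TendstoLocallyUniformlyOn F f atTop (U ∩ closure Ω)) :
    IsSubsolution Ω U H γ g f u := by
  refine isSubsolution_of_continuousOn hu (fun φ hφ x₀ hx₀ hmax => ?_) hΩ
  obtain ⟨r, hr, hrs⟩ := exists_closedBall_inter_subset (Ω := Ω) hU hx₀.1 univ_mem
  have hrU : Metric.closedBall x₀ r ∩ closure Ω ⊆ U ∩ closure Ω := fun y hy => (hrs hy).2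
  set K := Metric.closedBall x₀ r ∩ closure Ω with hK
  have hKc : IsCompact K := (isCompact_closedBall x₀ r).inter_right isClosed_closure
  have hx₀K : x₀ ∈ K := ⟨Metric.mem_closedBall_self hr.le, hx₀.2⟩
  have hψ : ContDiffOn ℝ 1 (fun y => φ y + ‖y - x₀‖ ^ 2) U :=
    hφ.add (contDiff_norm_sub_sq x₀).contDiffOn
  have hex : ∀ N, ∃ y ∈ K, IsMaxOn (fun y => v N y - (φ y + ‖y - x₀‖ ^ 2)) K y := fun N =>
    hKc.exists_isMaxOn ⟨x₀, hx₀K⟩ (((hv N).mono hrU).sub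
      (hψ.continuousOn.mono fun y hy => (hrU hy).1))
  choose x hxK hxmax using hex
  have hunif : TendstoUniformlyOn v u atTop K :=
    (tendstoLocallyUniformlyOn_iff_tendstoUniformlyOn_of_compact hKc).1 (hvu.mono hrU)
  have hx : Tendsto x atTop (𝓝 x₀) := by
    rw [tendsto_iff_norm_sub_tendsto_zero]
    -- Comparing the values at `x N` and `x₀` bounds `‖x N - x₀‖²` by the two errors of `v N`
    -- against `u`, hence the `ε / 2`.
    have hsq : Tendsto (fun N => ‖x N - x₀‖ ^ 2) atTop (𝓝 0) := by
      rw [Metric.tendsto_nhds]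
      intro ε hε
      filter_upwards [Metric.tendstoUniformlyOn_iff.1 hunif (ε / 2) (half_pos hε)] with N hN
      have h1 := hN _ (hxK N)
      have h2 := hN _ hx₀K
      have h3 : v N x₀ - (φ x₀ + ‖x₀ - x₀‖ ^ 2) ≤ v N (x N) - (φ (x N) + ‖x N - x₀‖ ^ 2) :=
        hxmax N hx₀K
      have h4 := hmax _ (hrU (hxK N))
      rw [sub_self, norm_zero] at h3
      rw [Real.dist_eq, abs_lt] at h1 h2
      rw [Real.dist_eq, sub_zero, abs_of_nonneg (by positivity)]
      linarith
    simpa using hsq.sqrt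
  have hp : Tendsto (fun N => gradient φ (x N) + (2 : ℝ) • (x N - x₀)) atTop
      (𝓝 (gradient φ x₀)) := by
    have h1 : Tendsto (fun N => (2 : ℝ) • (x N - x₀)) atTop (𝓝 0) := by
      simpa using (hx.sub_const x₀).const_smul (2 : ℝ)
    simpa using ((ContDiffOn.continuousAt_gradient hU hφ hx₀.1).tendsto.comp hx).add h1
  have hFx : Tendsto (fun N => F N (x N)) atTop (𝓝 (f x₀)) :=
    hFf.tendsto_comp (hf x₀ hx₀) hx₀
      (tendsto_nhdsWithin_iff.2 ⟨hx, Eventually.of_forall fun N => hrU (hxK N)⟩)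
  refine (viscosity_inequality_of_tendsto hH hγ hg hx₀.2 (fun N => (hxK N).2) hx hp hFx ?_).imp id
    And.right
  filter_upwards [hx.eventually (Metric.ball_mem_nhds x₀ hr)] with N hN
  have hgrad : gradient (fun y => φ y + ‖y - x₀‖ ^ 2) (x N)
      = gradient φ (x N) + (2 : ℝ) • (x N - x₀) := by
    refine gradient_eq_of_hasFDerivAt ?_
    rw [map_add]
    exact (ContDiffOn.hasFDerivAt_gradient hU hφ (hrU (hxK N)).1).add
      (hasFDerivAt_norm_sub_sq x₀ (x N))
  rw [← hgrad]
  exact (hsub N).of_isLocalMaxOn hΩ hU (hv N) hψ (hrU (hxK N))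
    (isLocalMaxOn_of_isMaxOn_closedBall_inter hN (hxmax N))

/-- The pairs `(f, u)` of a continuous right-hand side and a locally Lipschitz subsolution form a
convex set. -/
theorem convex_setOf_isSubsolution (hΩ : IsOpen Ω) (hΩ_C1 : HasC1Boundary Ω)
    (hH : ContinuousOn (Function.uncurry H) (closure Ω ×ˢ Set.univ))
    (hH_convex : ∀ x ∈ closure Ω, ConvexOn ℝ Set.univ (H x))
    (hγ : ContinuousOn γ (frontier Ω)) (hγ_oblique : IsOblique Ω γ)
    (hg : ContinuousOn g (frontier Ω)) (hU : IsOpen U) :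
    Convex ℝ {p : (E n → ℝ) × (E n → ℝ) | ContinuousOn p.1 (U ∩ closure Ω) ∧
      LocallyLipschitzOn (U ∩ closure Ω) p.2 ∧ IsSubsolution Ω U H γ g p.1 p.2} := by
  -- Strictly positive weights are required, as the doubling argument divides by both.
  rw [convex_iff_forall_pos]
  rintro ⟨f₁, u₁⟩ ⟨hf₁, hu₁, h₁⟩ ⟨f₂, u₂⟩ ⟨hf₂, hu₂, h₂⟩ a b ha hb hab
  exact ⟨(hf₁.const_mul a).add (hf₂.const_mul b), (hu₁.const_mul_real a).add (hu₂.const_mul_real b),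
    IsSubsolution.convex_combination hΩ hΩ_C1 hH hH_convex hγ hγ_oblique hg hU hf₁ hf₂ hu₁ hu₂ h₁ h₂
      ha hb hab⟩

end

/-! ### Locally uniform convergence of the series -/

section Series

variable {lam : ℕ → ℝ} {S : Set (E n)} {w : ℕ → E n → ℝ}

theorem UniformlyBoundedOnCompacts.summable (hw : UniformlyBoundedOnCompacts S w)
    (hlam_nonneg : ∀ k, 0 ≤ lam k) (hlam : Summable lam) {x : E n} (hx : x ∈ S) :
    Summable fun k => lam k * w k x := by
  obtain ⟨M, hM⟩ := hw {x} (singleton_subset_iff.2 hx) isCompact_singleton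
  refine Summable.of_norm_bounded (hlam.mul_right M) fun k => ?_
  rw [norm_mul, Real.norm_of_nonneg (hlam_nonneg k)]
  exact mul_le_mul_of_nonneg_left (hM k x rfl) (hlam_nonneg k)

/-- The normalized partial sums converge locally uniformly. -/
theorem UniformlyBoundedOnCompacts.tendstoLocallyUniformlyOn
    (hS : ∀ x ∈ S, ∃ K ⊆ S, IsCompact K ∧ K ∈ 𝓝[S] x) (hw : UniformlyBoundedOnCompacts S w)
    (hlam_nonneg : ∀ k, 0 ≤ lam k) (hlam : HasSum lam 1) :
    TendstoLocallyUniformlyOn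
      (fun N x => (∑ k ∈ Finset.range N, lam k)⁻¹ * ∑ k ∈ Finset.range N, lam k * w k x)
      (fun x => ∑' k, lam k * w k x) atTop S := by
  refine tendstoLocallyUniformlyOn_of_forall_exists_nhds fun x hx => ?_
  obtain ⟨K, hKS, hKc, hKx⟩ := hS x hx
  refine ⟨K, hKx, ?_⟩
  obtain ⟨M, hM⟩ := hw K hKS hKc
  have hbd : ∀ k, ∀ y ∈ K, ‖lam k * w k y‖ ≤ lam k * M := fun k y hy => by
    rw [norm_mul, Real.norm_of_nonneg (hlam_nonneg k)]
    exact mul_le_mul_of_nonneg_left (hM k y hy) (hlam_nonneg k)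
  have hunif := tendstoUniformlyOn_tsum_nat (hlam.summable.mul_right M) (s := K) hbd
  -- This bounds the error due to normalization, since the partial sums stay below `|M|` on `K`.
  have hΛ : Tendsto (fun N => |(∑ k ∈ Finset.range N, lam k)⁻¹ - 1| * |M|) atTop (𝓝 0) := by
    have := (((hlam.tendsto_sum_nat.inv₀ one_ne_zero).sub_const 1).abs).mul_const |M|
    simpa using this
  rw [Metric.tendstoUniformlyOn_iff] at hunif ⊢
  intro ε hε
  filter_upwards [hunif (ε / 2) (half_pos hε), hΛ.eventually_lt_const (half_pos hε)] with N h1 h2 y hy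
  have h3 := h1 y hy
  set Λ := ∑ k ∈ Finset.range N, lam k with hΛdef
  have hΛ1 : Λ ≤ 1 := sum_le_hasSum _ (fun k _ => hlam_nonneg k) hlam
  have hΛ0 : 0 ≤ Λ := Finset.sum_nonneg fun k _ => hlam_nonneg k
  set s := ∑ k ∈ Finset.range N, lam k * w k y
  have h4 : |s| ≤ |M| := by
    calc |s| ≤ ∑ k ∈ Finset.range N, lam k * M := norm_sum_le_of_le _ fun k _ => hbd k y hy
      _ = Λ * M := by rw [← Finset.sum_mul]
      _ ≤ Λ * |M| := mul_le_mul_of_nonneg_left (le_abs_self M) hΛ0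
      _ ≤ |M| := mul_le_of_le_one_left (abs_nonneg M) hΛ1
  rw [Real.dist_eq] at h3 ⊢
  calc |(∑' k, lam k * w k y) - Λ⁻¹ * s| = |((∑' k, lam k * w k y) - s) - (Λ⁻¹ - 1) * s| := by
        ring_nf
    _ ≤ |(∑' k, lam k * w k y) - s| + |(Λ⁻¹ - 1) * s| := abs_sub _ _
    _ ≤ |(∑' k, lam k * w k y) - s| + |Λ⁻¹ - 1| * |M| := by rw [abs_mul]; gcongr
    _ < ε := by linarith

end Series

end ObliqueHJ

/-! ### The theorem for series -/

theorem theorem2p2 (n : ℕ)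
    (Ω : Set (ObliqueHJ.E n)) (hΩ_open : IsOpen Ω) (hΩ_conn : IsConnected Ω)
    (hΩ_C1 : ObliqueHJ.HasC1Boundary Ω)
    (H : ObliqueHJ.E n → ObliqueHJ.E n → ℝ)
    (hH_cont : ContinuousOn (Function.uncurry H) (closure Ω ×ˢ Set.univ))
    (hH_convex : ∀ x ∈ closure Ω, ConvexOn ℝ Set.univ (H x))
    (γ : ObliqueHJ.E n → ObliqueHJ.E n) (hγ_cont : ContinuousOn γ (frontier Ω))
    (hγ_oblique : ObliqueHJ.IsOblique Ω γ)
    (g : ObliqueHJ.E n → ℝ) (hg_cont : ContinuousOn g (frontier Ω))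
    (U : Set (ObliqueHJ.E n)) (hU : IsOpen U)
    (f u : ℕ → ObliqueHJ.E n → ℝ)
    (hf_cont : ∀ k, ContinuousOn (f k) (U ∩ closure Ω))
    (hu_lip : ∀ k, LocallyLipschitzOn (U ∩ closure Ω) (u k))
    (hu_sub : ∀ k, ObliqueHJ.IsSubsolution Ω U H γ g (f k) (u k))
    (lam : ℕ → ℝ) (hlam_nonneg : ∀ k, 0 ≤ lam k) (hlam_sum : HasSum lam 1)
    (hu_bdd : ObliqueHJ.UniformlyBoundedOnCompacts (U ∩ closure Ω) u)
    (hf_bdd : ObliqueHJ.UniformlyBoundedOnCompacts (U ∩ closure Ω) f) :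
    (∀ x ∈ U ∩ closure Ω, Summable fun k => lam k * u k x) ∧
    (∀ x ∈ U ∩ closure Ω, Summable fun k => lam k * f k x) ∧
    ContinuousOn (fun x => ∑' k, lam k * f k x) (U ∩ closure Ω) ∧
    ObliqueHJ.IsSubsolution Ω U H γ g
      (fun x => ∑' k, lam k * f k x) (fun x => ∑' k, lam k * u k x) := by
  have hS : ∀ x ∈ U ∩ closure Ω, ∃ K ⊆ U ∩ closure Ω, IsCompact K ∧ K ∈ 𝓝[U ∩ closure Ω] x := by
    intro x hx
    obtain ⟨r, hr, hrs⟩ := ObliqueHJ.exists_closedBall_inter_subset (Ω := Ω) hU hx.1 univ_mem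
    refine ⟨Metric.closedBall x r ∩ closure Ω, fun y hy => (hrs hy).2,
      (isCompact_closedBall x r).inter_right isClosed_closure, ?_⟩
    filter_upwards [self_mem_nhdsWithin,
      mem_nhdsWithin_of_mem_nhds (Metric.closedBall_mem_nhds x hr)] with y hy hyr using ⟨hyr, hy.2⟩
  -- Early weights may all vanish; the shift by `N₀` makes every normalization legitimate.
  obtain ⟨N₀, hN₀⟩ := eventually_atTop.1
    (hlam_sum.tendsto_sum_nat.eventually_const_lt one_pos)
  have hmem : ∀ N, (Finset.range (N + N₀)).centerMass lam (fun k => (f k, u k)) ∈ _ := fun N =>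
    (ObliqueHJ.convex_setOf_isSubsolution hΩ_open hΩ_C1 hH_cont hH_convex hγ_cont hγ_oblique hg_cont
      hU).centerMass_mem (fun k _ => hlam_nonneg k) (hN₀ _ (Nat.le_add_left _ _))
      (fun k _ => ⟨hf_cont k, hu_lip k, hu_sub k⟩)
  have hfst : ∀ N, ((Finset.range (N + N₀)).centerMass lam (fun k => (f k, u k))).1 = fun x =>
      (∑ k ∈ Finset.range (N + N₀), lam k)⁻¹ * ∑ k ∈ Finset.range (N + N₀), lam k * f k x := by
    intro N
    ext x
    simp [Finset.centerMass, Prod.fst_sum]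
  have hsnd : ∀ N, ((Finset.range (N + N₀)).centerMass lam (fun k => (f k, u k))).2 = fun x =>
      (∑ k ∈ Finset.range (N + N₀), lam k)⁻¹ * ∑ k ∈ Finset.range (N + N₀), lam k * u k x := by
    intro N
    ext x
    simp [Finset.centerMass, Prod.snd_sum]
  simp only [mem_ofPred_eq, hfst, hsnd] at hmem
  have hshift : ∀ {F : ℕ → ObliqueHJ.E n → ℝ} {w : ObliqueHJ.E n → ℝ},
      TendstoLocallyUniformlyOn F w atTop (U ∩ closure Ω) →
      TendstoLocallyUniformlyOn (fun N => F (N + N₀)) w atTop (U ∩ closure Ω) :=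
    fun h v hv x hx => (h v hv x hx).imp fun t ht =>
      ⟨ht.1, (tendsto_add_atTop_nat N₀).eventually ht.2⟩
  have hu_lim := hshift (hu_bdd.tendstoLocallyUniformlyOn hS hlam_nonneg hlam_sum)
  have hf_lim := hshift (hf_bdd.tendstoLocallyUniformlyOn hS hlam_nonneg hlam_sum)
  -- The local Lipschitz property may be lost in the limit, but stability only needs continuity.
  have hu_c := hu_lim.continuousOn (Frequently.of_forall fun N => (hmem N).2.1.continuousOn)
  have hf_c := hf_lim.continuousOn (Frequently.of_forall fun N => (hmem N).1)
  exact ⟨fun x hx => hu_bdd.summable hlam_nonneg hlam_sum.summable hx,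
    fun x hx => hf_bdd.summable hlam_nonneg hlam_sum.summable hx, hf_c,
    ObliqueHJ.isSubsolution_of_tendstoLocallyUniformlyOn hΩ_open hH_cont hγ_cont hg_cont hU
      (fun N => (hmem N).2.1.continuousOn) hf_c hu_c (fun N => (hmem N).2.2) hu_lim hf_lim⟩
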